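/- Fix a set $A$ of atoms. A \emph{supported set} over $A$ is a set $X$ with a map $s_X\colon X\to\mathcal P_{\mathsf f}(A)$ into the finite subsets of $A$; a \emph{supported map} $f\colon X\to Y$ is a map with $s_Y(f(x))\subseteq s_X(x)$ for all $x\in X$. These form the category $\mathsf{Supp}(A)$. Let $M\le A^A$ be a monoid of maps $A\to A$ under composition, and let $X$ be a set with an action of $M$. A subset $S\subseteq A$ \emph{supports} $x\in X$ if $m\cdot x=m'\cdot x$ for all $m,m'\in M$ that agree on $S$; $X$ is a \emph{nominal $M$-set} if each of its elements is supported by a finite set. $\mathsf{Nom}(M)$ is the category of nominal $M$-sets and equivariant maps, and $U\colon\mathsf{Nom}(M)\to\mathsf{Supp}(A)$ is the functor that keeps the underlying set and map and sets $s_{UX}(x)=\bigcap\{S\subseteq A\mid S\text{ finite and supports }x\}$. The monoid $M$ \emph{admits least supports} if every element of every nominal $M$-set has a least finite support, and it is \emph{lock-free} if for every finite $R\subseteq A$ and $a\in A\setminus R$ there is $\ell\in M$ that fixes $R$ pointwise and satisfies $\ell(a)\ne a$. For finite $S\subseteq A$ and $m\in M$ let $[m]_S$ be the class of all $m'\in M$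 that agree with $m$ on $S$. Let $F\colon\mathsf{Supp}(A)\to\mathsf{Nom}(M)$ be given by $FX=\{([m]_{s_X(x)},x)\mid x\in X,\ m\in M\}$ with action $\ell\cdot([m],x)=([\ell m],x)$ and $Ff([m]_{s_X(x)},x)=([m]_{s_Y(f(x))},f(x))$. A functor $U\colon\mathcal D\to\mathcal C$ is \emph{monadic} via a monad $T$ on $\mathcal C$ if there is an isomorphism of categories from $\mathcal D$ to the Eilenberg--Moore category of $T$ that carries $U$ to the forgetful functor. Let $\mathbb A$ be a countably infinite set. In each of the following three cases the monoid $M\le A^A$ admits least supports and is lock-free; $F$ is left adjoint to $U$ with unit $x\mapsto([\mathrm{id}]_{s_X(x)},x)$; and $U\colon\mathsf{Nom}(M)\to\mathsf{Supp}(A)$ is monadic via the given monad $T$, to which the monad of the adjunction $F\dashv U$ is isomorphic through $([m]_{s_X(x)},x)\mapsto(m|_{s_X(x)},x)$. 1. Nominal sets for the equality symmetry: $A=\mathbb A$, $M$ is the group of bijections $\mathbb A\to\mathbb A$ fixing all but finitely many atoms, and $TX=\{(\pi,x)\mid x\in X,\ \pi\colon s_X(x)\to\mathbb A\text{ injective}\}$.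 2. Nominal renaming sets: $A=\mathbb A$, $M$ is the monoid of all maps $\mathbb A\to\mathbb A$ fixing all but finitely many atoms, and $TX=\{(\pi,x)\mid x\in X,\ \pi\colon s_X(x)\to\mathbb A\}$. 3. Nominal sets for the total order symmetry: $A=\mathbb Q$, $M$ is the group of monotone bijections $\mathbb Q\to\mathbb Q$, and $TX=\{(\pi,x)\mid x\in X,\ \pi\colon s_X(x)\to\mathbb Q,\ \pi(q)<\pi(p)\text{ for all }q<p\text{ in }s_X(x)\}$. In all three cases $s_{TX}(\pi,x)=\pi[s_X(x)]$, $Tf(\pi,x)=(\pi|_{s_Y(f(x))},f(x))$ for supported $f\colon X\to Y$, the unit sends $x$ to $(s_X(x)\hookrightarrow A,\,x)$ and the multiplication sends $(\rho,(\pi,x))$ to $(\rho\circ\pi,x)$. Moreover, $\mathbb Q\cong\mathbb A$, and for every bijection $e\colon\mathbb Q\to\mathbb A$ the composite of $U$ in case 3 with the relabelling functor $\mathsf{Supp}(\mathbb Q)\to\mathsf{Supp}(\mathbb A)$, $(X,s_X)\mapsto(X,\,x\mapsto e[s_X(x)])$, is monadic (via some monad on $\mathsf{Supp}(\mathbb A)$).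 -/

import Mathlib

open CategoryTheory

universe u v w

namespace Nominal

/-! ### Supported sets -/

/-- A supported set over `A`: a set together with a map to the finite subsets of `A`. -/
structure SuppSet (A : Type v) : Type (max v (w + 1)) where
  carrier : Type w
  supp : carrier → Finset A

/-- A supported map: it may forget atoms but never introduces new ones. -/
@[ext]
structure SuppSet.Hom {A : Type v} (X Y : SuppSet.{v, w} A) : Type w where
  toFun : X.carrier → Y.carrier
  supp_subset : ∀ x, Y.supp (toFun x) ⊆ X.supp x

instance {A : Type v} : Category.{w} (SuppSet.{v, w} A) where
  Hom X Y := SuppSet.Hom X Y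
  id _ := ⟨fun x => x, fun _ => Finset.Subset.refl _⟩
  comp f g := ⟨fun x => g.toFun (f.toFun x),
    fun x => (g.supp_subset (f.toFun x)).trans (f.supp_subset x)⟩

/-- Relabelling the atoms along a bijection. -/
def SuppSet.relabel {A : Type u} {B : Type v} (e : A ≃ B) :
    SuppSet.{u, w} A ⥤ SuppSet.{v, w} B where
  obj X := ⟨X.carrier, fun x => (X.supp x).map e.toEmbedding⟩
  map f := ⟨f.toFun, fun x => Finset.map_subset_map.2 (f.supp_subset x)⟩

/-! ### Nominal `M`-sets for a monoid `M` of maps `A → A` -/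

/-- `S` supports `x` if any two elements of `M` that are identical on `S` act in the same
way on `x`. -/
def Supports {A : Type v} (M : Submonoid (Function.End A)) {X : Type w} [MulAction M X]
    (S : Set A) (x : X) : Prop :=
  ∀ m m' : M, (∀ a ∈ S, m.1 a = m'.1 a) → m • x = m' • x

/-- A nominal `M`-set: an `M`-set in which every element has a finite support. -/
structure NomSet {A : Type v} (M : Submonoid (Function.End A)) : Type (max v (w + 1)) where
  carrier : Type w
  [action : MulAction M carrier]
  nominal : ∀ x : carrier, ∃ S : Finset A, Supports M (S : Set A) x

attribute [instance] NomSet.action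

/-- Morphisms of nominal `M`-sets are the equivariant maps. -/
@[ext]
structure NomSet.Hom {A : Type v} {M : Submonoid (Function.End A)} (X Y : NomSet.{v, w} M) :
    Type w where
  hom : X.carrier →[M] Y.carrier

instance {A : Type v} {M : Submonoid (Function.End A)} : Category.{w} (NomSet.{v, w} M) where
  Hom X Y := NomSet.Hom X Y
  id X := ⟨MulActionHom.id M⟩
  comp f g := ⟨g.hom.comp f.hom⟩

/-- Every element of every nominal `M`-set (in the universe `w`) has a least finite support. -/
def AdmitsLeastSupports {A : Type v} (M : Submonoid (Function.End A)) : Prop :=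
  ∀ (X : NomSet.{v, w} M) (x : X.carrier),
    ∃ S : Finset A, IsLeast {S : Finset A | Supports M (S : Set A) x} S

/-- Lock-freeness: whenever `a` is outside the finite set `R`, some element of `M` moves `a`
while fixing `R` pointwise. -/
def LockFree {A : Type v} (M : Submonoid (Function.End A)) : Prop :=
  ∀ (R : Finset A) (a : A), a ∉ R → ∃ l ∈ M, (∀ b ∈ R, l b = b) ∧ l a ≠ a

theorem finite_supp {A : Type v} {M : Submonoid (Function.End A)} (X : NomSet.{v, w} M)
    (x : X.carrier) : {a : A | ∀ S : Finset A, Supports M (S : Set A) x → a ∈ S}.Finite := by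
  obtain ⟨S, hS⟩ := X.nominal x
  exact S.finite_toSet.subset fun a ha => ha S hS

/-- The intersection of all finite supports of `x`; it is the least finite support whenever there
is one. -/
noncomputable def NomSet.supp {A : Type v} {M : Submonoid (Function.End A)} (X : NomSet.{v, w} M)
    (x : X.carrier) : Finset A :=
  (finite_supp X x).toFinset

theorem NomSet.mem_supp {A : Type v} {M : Submonoid (Function.End A)} {X : NomSet.{v, w} M}
    {x : X.carrier} {a : A} :
    a ∈ X.supp x ↔ ∀ S : Finset A, Supports M (S : Set A) x → a ∈ S := by
  simp [NomSet.supp]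

theorem Supports.map {A : Type v} {M : Submonoid (Function.End A)} {X Y : NomSet.{v, w} M}
    (f : X.carrier →[M] Y.carrier) {S : Set A} {x : X.carrier} (h : Supports M S x) :
    Supports M S (f x) := by
  intro m m' hm
  rw [← map_smul, ← map_smul, h m m' hm]

/-- The forgetful functor from nominal `M`-sets to supported sets. -/
noncomputable def forgetToSupp {A : Type v} (M : Submonoid (Function.End A)) :
    NomSet.{v, w} M ⥤ SuppSet.{v, w} A where
  obj X := ⟨X.carrier, X.supp⟩
  map f := ⟨fun x => f.hom x, fun _ _ ha =>
    NomSet.mem_supp.2 fun S hS => NomSet.mem_supp.1 ha S (hS.map f.hom)⟩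

/-! ### The free nominal `M`-set on a supported set -/

/-- Being identical on `S`. -/
def restSetoid {A : Type v} (M : Submonoid (Function.End A)) (S : Finset A) : Setoid M where
  r m m' := ∀ a ∈ S, m.1 a = m'.1 a
  iseqv := ⟨fun _ _ _ => rfl, fun h a ha => (h a ha).symm,
    fun h h' a ha => (h a ha).trans (h' a ha)⟩

/-- The set of classes `[m]_S` of elements of `M` identical on `S`. -/
def RestMon {A : Type v} (M : Submonoid (Function.End A)) (S : Finset A) : Type v :=
  Quotient (restSetoid M S)

/-- The class `[m]_S`. -/
def RestMon.mk {A : Type v} {M : Submonoid (Function.End A)} (S : Finset A) (m : M) :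
    RestMon M S :=
  Quotient.mk (restSetoid M S) m

/-- `[m]_S ↦ [m]_R` for `R ⊆ S`. -/
def RestMon.restrict {A : Type v} {M : Submonoid (Function.End A)} {R S : Finset A} (h : R ⊆ S) :
    RestMon M S → RestMon M R :=
  Quotient.map' (s₁ := restSetoid M S) (s₂ := restSetoid M R) id
    (fun _ _ hm a ha => hm a (h ha))

/-- The action `l • [m]_S = [l * m]_S`. -/
instance {A : Type v} (M : Submonoid (Function.End A)) (S : Finset A) :
    MulAction M (RestMon M S) where
  smul l := Quotient.map' (s₁ := restSetoid M S) (s₂ := restSetoid M S) (fun m => l * m)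
    (fun _ _ hm a ha => congrArg l.1 (hm a ha))
  one_smul q := by
    induction q using Quotient.inductionOn'
    exact congrArg (RestMon.mk S) (one_mul _)
  mul_smul l l' q := by
    induction q using Quotient.inductionOn'
    exact congrArg (RestMon.mk S) (mul_assoc _ _ _)

/-- The free nominal `M`-set on `X`: the pairs `([m]_{supp x}, x)`, with the action on the
first component. -/
def freeObj {A : Type v} (M : Submonoid (Function.End A)) (X : SuppSet.{v, max u v} A) :
    NomSet.{v, max u v} M where
  carrier := Σ x : X.carrier, RestMon M (X.supp x)
  action :=
    { smul := fun l p => ⟨p.1, l • p.2⟩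
      one_smul := fun p => Sigma.ext rfl (heq_of_eq (one_smul M p.2))
      mul_smul := fun l l' p => Sigma.ext rfl (heq_of_eq (mul_smul l l' p.2)) }
  nominal := by
    classical
    rintro ⟨x, q⟩
    induction q using Quotient.inductionOn' with
    | h m =>
      refine ⟨(X.supp x).image m.1, fun l l' h => Sigma.ext rfl (heq_of_eq ?_)⟩
      exact Quotient.sound (s := restSetoid M (X.supp x)) fun a ha =>
        h (m.1 a) (by exact_mod_cast Finset.mem_image_of_mem m.1 ha)

/-- The free functor, `([m]_{supp x}, x) ↦ ([m]_{supp (f x)}, f x)` on maps. -/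
def free {A : Type v} (M : Submonoid (Function.End A)) :
    SuppSet.{v, max u v} A ⥤ NomSet.{v, max u v} M where
  obj X := freeObj.{u, v} M X
  map {X Y} f := ⟨{
    toFun := fun p : (freeObj.{u, v} M X).carrier =>
      (⟨f.toFun p.1, RestMon.restrict (f.supp_subset p.1) p.2⟩ : (freeObj.{u, v} M Y).carrier)
    map_smul' := by
      rintro l ⟨x, q⟩
      induction q using Quotient.inductionOn'
      rfl }⟩
  map_id X := by
    refine NomSet.Hom.ext (MulActionHom.ext ?_)
    rintro ⟨x, q⟩
    induction q using Quotient.inductionOn'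
    rfl
  map_comp f g := by
    refine NomSet.Hom.ext (MulActionHom.ext ?_)
    rintro ⟨x, q⟩
    induction q using Quotient.inductionOn'
    rfl

/-! ### Explicit monads on supported sets -/

/-- The finite set of values of a map on a finite set of atoms. -/
noncomputable def imageOf {A : Type v} {S : Finset A} (p : S → A) : Finset A :=
  (Set.finite_range p).toFinset

theorem mem_imageOf {A : Type v} {S : Finset A} (p : S → A) (a : S) : p a ∈ imageOf p := by
  simp [imageOf]

theorem imageOf_subset {A : Type v} {S R : Finset A} {p : S → A} (h : ∀ a, p a ∈ R) :
    imageOf p ⊆ R := by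
  intro b hb
  obtain ⟨a, rfl⟩ := (Set.finite_range p).mem_toFinset.1 hb
  exact h a

/-- A class of maps from finite sets of atoms to `A` that contains the inclusions and is closed
under restriction and composition. -/
structure OpClass (A : Type v) where
  /-- The maps `S → A` that belong to the class. -/
  IsOp : ∀ S : Finset A, (S → A) → Prop
  incl : ∀ S : Finset A, IsOp S (fun a => a.1)
  restrict : ∀ (R S : Finset A) (h : R ⊆ S) (p : S → A), IsOp S p →
    IsOp R (fun a => p ⟨a.1, h a.2⟩)
  comp : ∀ (S : Finset A) (p : S → A) (r : imageOf p → A), IsOp S p → IsOp (imageOf p) r →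
    IsOp S (fun a => r ⟨p a, mem_imageOf p a⟩)

/-- The supported set of pairs `(p, x)` with `x` in `X` and `p` a map `supp x → A` of the given
class; the support of `(p, x)` is the image of `p`. -/
noncomputable def OpClass.obj {A : Type v} (C : OpClass A) (X : SuppSet.{v, max u v} A) :
    SuppSet.{v, max u v} A where
  carrier := Σ x : X.carrier, {p : X.supp x → A // C.IsOp (X.supp x) p}
  supp t := imageOf t.2.1

/-- The monad `X ↦ {(p, x)}`: maps act by restriction of `p`, the unit sends `x` to the
inclusion of `supp x`, and the multiplication sends `(r, (p, x))` to `(r ∘ p, x)`. -/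
noncomputable def OpClass.monad {A : Type v} (C : OpClass A) :
    CategoryTheory.Monad (SuppSet.{v, max u v} A) where
  obj X := OpClass.obj.{u, v} C X
  map f :=
    { toFun := fun t => ⟨f.toFun t.1, ⟨fun a => t.2.1 ⟨a.1, f.supp_subset t.1 a.2⟩,
        C.restrict _ _ (f.supp_subset t.1) t.2.1 t.2.2⟩⟩
      supp_subset := fun t => imageOf_subset fun _ => mem_imageOf t.2.1 _ }
  map_id _ := rfl
  map_comp _ _ := rfl
  η :=
    { app := fun _ =>
        { toFun := fun x => ⟨x, ⟨fun a => a.1, C.incl _⟩⟩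
          supp_subset := fun _ => imageOf_subset fun a => a.2 }
      naturality := fun _ _ _ => rfl }
  μ :=
    { app := fun _ =>
        { toFun := fun t => ⟨t.1.1, ⟨fun a => t.2.1 ⟨t.1.2.1 a, mem_imageOf t.1.2.1 a⟩,
            C.comp _ t.1.2.1 t.2.1 t.1.2.2 t.2.2⟩⟩
          supp_subset := fun t => imageOf_subset fun _ => mem_imageOf t.2.1 _ }
      naturality := fun _ _ _ => rfl }
  assoc _ := rfl
  left_unit _ := rfl
  right_unit _ := rfl

/-- All injective maps. -/
def injectiveOps (A : Type v) : OpClass A where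
  IsOp _ p := Function.Injective p
  incl _ := Subtype.val_injective
  restrict _ _ _ _ hp _ _ hab := Subtype.ext (Subtype.mk.inj (hp hab))
  comp _ _ _ hp hr _ _ hab := hp (Subtype.mk.inj (hr hab))

/-- All maps. -/
def allOps (A : Type v) : OpClass A where
  IsOp _ _ := True
  incl _ := trivial
  restrict _ _ _ _ _ := trivial
  comp _ _ _ _ _ := trivial

/-- All maps that preserve the strict order. -/
def strictMonoOps (A : Type v) [LinearOrder A] : OpClass A where
  IsOp _ p := ∀ a b, a < b → p a < p b
  incl _ _ _ hab := hab
  restrict _ _ h _ hp a b hab := hp ⟨a.1, h a.2⟩ ⟨b.1, h b.2⟩ hab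
  comp _ _ _ hp hr a b hab := hr _ _ (hp a b hab)

/-! ### The three monoids -/

/-- The finite permutations: bijections fixing all but finitely many atoms. -/
def finPerm (A : Type v) : Submonoid (Function.End A) where
  carrier := {f | Function.Bijective f ∧ {a | f a ≠ a}.Finite}
  one_mem' := ⟨Function.bijective_id,
    Set.finite_empty.subset fun a ha => ha (show (1 : Function.End A) a = a from rfl)⟩
  mul_mem' {f g} hf hg := ⟨hf.1.comp hg.1, (hf.2.union hg.2).subset fun a ha => by
    by_contra h
    simp only [Set.mem_union, Set.mem_ofPred_eq, not_or, not_not] at h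
    exact ha (show f (g a) = a by rw [h.2, h.1])⟩

/-- The finite renamings: maps fixing all but finitely many atoms. -/
def finRename (A : Type v) : Submonoid (Function.End A) where
  carrier := {f | {a | f a ≠ a}.Finite}
  one_mem' := Set.finite_empty.subset fun a ha => ha (show (1 : Function.End A) a = a from rfl)
  mul_mem' {f g} hf hg := (hf.union hg).subset fun a ha => by
    by_contra h
    simp only [Set.mem_union, Set.mem_ofPred_eq, not_or, not_not] at h
    exact ha (show f (g a) = a by rw [h.2, h.1])

/-- The monotone bijections of a linear order. -/
def ordAut (A : Type v) [LinearOrder A] : Submonoid (Function.End A) where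
  carrier := {f | Function.Bijective f ∧ Monotone (f : A → A)}
  one_mem' := ⟨Function.bijective_id, monotone_id⟩
  mul_mem' hf hg := ⟨hf.1.comp hg.1, hf.2.comp hg.2⟩

/-! ### Monadicity -/

/-- `U : D ⥤ C` exhibits `D` as the Eilenberg-Moore category of `T`: there is an isomorphism of
categories (an equivalence that is bijective on objects) `D ≅ EM(T)` that carries `U` to the
forgetful functor of `EM(T)`. -/
def IsMonadicVia {C : Type*} [Category C] {D : Type*} [Category D] (U : D ⥤ C)
    (T : CategoryTheory.Monad C) : Prop :=
  ∃ K : D ⥤ T.Algebra, K.IsEquivalence ∧ Function.Bijective K.obj ∧ K ⋙ T.forget = U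

/-- Nominal `M`-sets are the algebras of the explicit monad of the class `C`, which is the monad
of the adjunction between the free and the forgetful functor: the unit of the adjunction is
`x ↦ ([1], x)`, and the isomorphism of monads sends `([m], x)` to `(m restricted to supp x, x)`. -/
def IsMonadicInstance {A : Type v} (M : Submonoid (Function.End A)) (C : OpClass A) : Prop :=
  IsMonadicVia (forgetToSupp.{v, max u v} M) (OpClass.monad.{u, v} C) ∧
  ∃ adj : free.{u, v} M ⊣ forgetToSupp.{v, max u v} M,
    (∀ (X : SuppSet.{v, max u v} A) (x : X.carrier),
      (adj.unit.app X).toFun x =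
        (⟨x, RestMon.mk (X.supp x) 1⟩ : (freeObj.{u, v} M X).carrier)) ∧
    ∃ φ : adj.toMonad ≅ OpClass.monad.{u, v} C,
      ∀ (X : SuppSet.{v, max u v} A) (x : X.carrier) (m : M),
        ∃ h : C.IsOp (X.supp x) (fun a => m.1 a.1),
          (φ.hom.app X).toFun
              (⟨x, RestMon.mk (X.supp x) m⟩ : (freeObj.{u, v} M X).carrier) =
            (⟨x, ⟨fun a => m.1 a.1, h⟩⟩ : (OpClass.obj.{u, v} C X).carrier)

end Nominal

/-!
Suppose every element of a nominal `M`-set has a least finite support. Then `m • y` depends only on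
the restriction of `m` to the support of `y`, so `([m], y) ↦ m • y` is well defined; it is the
counit of `F ⊣ U`. Conversely, an algebra `a` of the monad of `F ⊣ U` acts by `m • x = a ([m], x)`,
and the prescribed support of `x` certainly supports `x`. It is the least finite support because of
lock-freeness: if a finite support `R` omits some `b` in the prescribed support, there is an `l`
fixing `R` and the rest of the prescribed support but moving `b`; then `l • x = x`, although the
support of `a ([l], x)` lies in the image of the support of `x` under `l`, which does not contain
`b`.

In each example the restrictions of elements of `M` to finite sets of atoms are all the injective,
arbitrary, or strictly monotone maps. This describes the monad, and it produces the elements of `M`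
required for least supports and for lock-freeness. Relabelling the atoms is an isomorphism of
categories, and a monad can be transported along it.
-/

namespace Nominal

/-! ### Transport of monadicity -/

section Monadicity

variable {C E : Type*} [Category C] [Category E]

/-- The monad `T` transported along the equivalence `e`, with underlying functor
`e.inverse ⋙ T ⋙ e.functor`. -/
def conjMonad (T : Monad C) (e : C ≌ E) : Monad E where
  toFunctor := e.inverse ⋙ T.toFunctor ⋙ e.functor
  η := e.counitInv ≫ Functor.whiskerLeft e.inverse (Functor.whiskerRight T.η e.functor)
  μ.app X := e.functor.map (T.map (e.unitInv.app (T.obj (e.inverse.obj X))) ≫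
    T.μ.app (e.inverse.obj X))
  μ.naturality X Y f := by
    dsimp
    simp only [← Functor.map_comp, ← Functor.map_comp_assoc, Category.assoc, ← T.mu_naturality,
      e.unitInv_naturality]
  assoc X := by
    dsimp
    simp only [← Functor.map_comp, Category.assoc, ← T.mu_naturality_assoc, ← T.assoc]
    simp only [← Functor.map_comp_assoc, e.unitInv_naturality]
  left_unit X := by
    dsimp
    simp only [Category.assoc, ← Functor.map_comp, ← T.unit_naturality_assoc]
    simp
  right_unit X := by
    dsimp
    simp only [← Functor.map_comp, ← Functor.map_comp_assoc]
    simp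

/-- Transport of algebras along the equivalence `e`: the structure map `a` is sent to
`e.functor.map a`, up to the unit isomorphism of `e`. -/
def conjAlgebra (T : Monad C) (e : C ≌ E) : T.Algebra ⥤ (conjMonad T e).Algebra where
  obj Y :=
    { A := e.functor.obj Y.A
      a := e.functor.map (T.map (e.unitInv.app Y.A) ≫ Y.a)
      unit := by
        dsimp [conjMonad]
        simp only [← Functor.map_comp, Category.assoc, ← T.unit_naturality_assoc, Y.unit]
        simp
      assoc := by
        dsimp [conjMonad]
        simp only [← Functor.map_comp, Category.assoc, ← T.mu_naturality_assoc, Y.assoc]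
        simp only [← Functor.map_comp_assoc, e.unitInv_naturality] }
  map f :=
    { f := e.functor.map f.f
      h := by
        dsimp [conjMonad]
        simp only [← Functor.map_comp, ← Functor.map_comp_assoc, Category.assoc,
          e.unitInv_naturality, ← f.h] }

instance (T : Monad C) (e : C ≌ E) : (conjAlgebra T e).Faithful where
  map_injective h :=
    Monad.Algebra.Hom.ext (e.functor.map_injective (congrArg Monad.Algebra.Hom.f h))

theorem conjAlgebra_full (T : Monad C) (e : C ≌ E) : (conjAlgebra T e).Full where
  map_surjective {X Y} k := by
    obtain ⟨g, hg⟩ : ∃ g : X.A ⟶ Y.A, e.functor.map g = k.f := e.functor.map_surjective k.f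
    have h : T.map (e.inverse.map (e.functor.map g)) ≫ T.map (e.unitInv.app Y.A) ≫ Y.a =
        (T.map (e.unitInv.app X.A) ≫ X.a) ≫ g := by
      apply e.functor.map_injective
      rw [Functor.map_comp, Functor.map_comp e.functor (_ ≫ X.a), hg]
      exact k.h
    have hk : T.map g ≫ Y.a = X.a ≫ g := by
      rw [← cancel_epi (T.map (e.unitInv.app X.A))]
      simpa using h
    exact ⟨⟨g, hk⟩, Monad.Algebra.Hom.ext hg⟩

theorem conjAlgebra_obj_injective (T : Monad C) (e : C ≌ E)
    (he : Function.Injective e.functor.obj) : Function.Injective (conjAlgebra T e).obj := by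
  rintro ⟨A, a, _, _⟩ ⟨B, b, _, _⟩ h
  obtain rfl : A = B := he (congrArg Monad.Algebra.A h)
  obtain rfl : a = b := (cancel_epi _).1 (e.functor.map_injective
    (eq_of_heq (congr_arg_heq Monad.Algebra.a h)))
  rfl

theorem conjAlgebra_obj_surjective (T : Monad C) (e : C ≌ E)
    (he : Function.Surjective e.functor.obj) : Function.Surjective (conjAlgebra T e).obj := by
  rintro ⟨X, a, hu, ha⟩
  obtain ⟨Y, rfl⟩ := he X
  obtain ⟨a, rfl⟩ := e.functor.map_surjective a
  dsimp [conjMonad] at hu ha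
  have assoc : T.μ.app _ ≫ a = T.map (a ≫ e.unit.app Y) ≫ a := by
    rw [← cancel_epi (T.map (e.unitInv.app (T.obj _)))]
    apply e.functor.map_injective
    rw [← T.map_comp_assoc]
    simpa [← Functor.map_comp] using ha
  have unit_nat : T.η.app Y ≫ T.map (e.unit.app Y) = e.unit.app Y ≫ T.η.app _ :=
    (T.η.naturality (e.unit.app Y)).symm
  have mu_nat : T.μ.app Y ≫ T.map (e.unit.app Y) = T.map (T.map (e.unit.app Y)) ≫ T.μ.app _ :=
    (T.μ.naturality (e.unit.app Y)).symm
  refine ⟨⟨Y, T.map (e.unit.app Y) ≫ a, e.functor.map_injective ?_, ?_⟩, ?_⟩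
  · rw [reassoc_of% unit_nat]
    simpa [e.counitInv_app_functor] using hu
  · rw [reassoc_of% mu_nat, assoc]
    simp
  · simp [conjAlgebra]

theorem conjAlgebra_isEquivalence (T : Monad C) (e : C ≌ E)
    (he : Function.Surjective e.functor.obj) : (conjAlgebra T e).IsEquivalence where
  full := conjAlgebra_full T e
  essSurj := Functor.essSurj_of_surj (conjAlgebra_obj_surjective T e he)

theorem IsMonadicVia.comp_equivalence {D : Type*} [Category D] {U : D ⥤ C} {T : Monad C}
    (hU : IsMonadicVia U T) (e : C ≌ E) (he : Function.Bijective e.functor.obj) :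
    IsMonadicVia (U ⋙ e.functor) (conjMonad T e) := by
  obtain ⟨K, _, hK, rfl⟩ := hU
  have := conjAlgebra_isEquivalence T e he.2
  exact ⟨K ⋙ conjAlgebra T e, inferInstance,
    ⟨(conjAlgebra_obj_injective T e he.1).comp hK.1,
      (conjAlgebra_obj_surjective T e he.2).comp hK.2⟩, rfl⟩

theorem leftInverse_algebraFunctorOfMonadHom_obj {T T' : Monad C} (φ : T ≅ T') :
    Function.LeftInverse (Monad.algebraFunctorOfMonadHom φ.hom).obj
      (Monad.algebraFunctorOfMonadHom φ.inv).obj := by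
  rintro ⟨X, a, _, _⟩
  have h : φ.hom.app X ≫ φ.inv.app X = 𝟙 _ :=
    congrArg (fun ψ : T ⟶ T => ψ.app X) φ.hom_inv_id
  simp [reassoc_of% h, Monad.algebraFunctorOfMonadHom]

theorem IsMonadicVia.of_iso {D : Type*} [Category D] {U : D ⥤ C} {T T' : Monad C}
    (hU : IsMonadicVia U T) (φ : T ≅ T') : IsMonadicVia U T' := by
  obtain ⟨K, _, hK, rfl⟩ := hU
  have h : Function.Bijective (Monad.algebraFunctorOfMonadHom φ.inv).obj :=
    ⟨(leftInverse_algebraFunctorOfMonadHom_obj φ).injective,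
      (leftInverse_algebraFunctorOfMonadHom_obj φ.symm).surjective⟩
  have : (Monad.algebraFunctorOfMonadHom φ.inv).IsEquivalence :=
    (Monad.algebraEquivOfIsoMonads φ).isEquivalence_functor
  exact ⟨K ⋙ Monad.algebraFunctorOfMonadHom φ.inv, inferInstance, h.comp hK, rfl⟩

theorem algebra_eq_of_eqToHom {T : Monad C} {X Y : T.Algebra}
    (h : X.A = Y.A) (ha : T.map (eqToHom h) ≫ Y.a = X.a ≫ eqToHom h) : X = Y := by
  obtain ⟨X, a, _, _⟩ := X
  obtain ⟨Y, b, _, _⟩ := Y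
  obtain rfl : X = Y := h
  obtain rfl : b = a := by simpa using ha
  rfl

theorem IsMonadicVia.of_comparison {D : Type*} [Category D] {F : C ⥤ D} {U : D ⥤ C}
    [U.Faithful] (adj : F ⊣ U) (hfull : (Monad.comparison adj).Full)
    (hbij : Function.Bijective (Monad.comparison adj).obj) : IsMonadicVia U adj.toMonad :=
  have := Functor.essSurj_of_surj hbij.2
  ⟨Monad.comparison adj, {}, hbij, rfl⟩

end Monadicity

/-! ### The free-forgetful adjunction -/

section LeastSupports

variable {A : Type v} {M : Submonoid (Function.End A)}

theorem Supports.mono {X : Type w} [MulAction M X] {S R : Set A} {x : X} (h : Supports M S x)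
    (hSR : S ⊆ R) : Supports M R x :=
  fun m m' hm => h m m' fun a ha => hm a (hSR ha)

theorem AdmitsLeastSupports.supports_supp (h : AdmitsLeastSupports.{v, w} M)
    (X : NomSet.{v, w} M) (x : X.carrier) : Supports M (X.supp x : Set A) x := by
  obtain ⟨S, hS, hmin⟩ := h X x
  exact hS.mono fun a ha => NomSet.mem_supp.2 fun R hR => hmin hR ha

end LeastSupports

section Adjunction

variable {A : Type v} {M : Submonoid (Function.End A)}

/-- The element `([m], x)` of the free nominal `M`-set on `X`. -/
abbrev freeMk {X : SuppSet.{v, max u v} A} (m : M) (x : X.carrier) : (freeObj.{u, v} M X).carrier :=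
  ⟨x, RestMon.mk (X.supp x) m⟩

theorem freeMk_induction {X : SuppSet.{v, max u v} A} {p : (freeObj.{u, v} M X).carrier → Prop}
    (h : ∀ m x, p (freeMk m x)) (t : (freeObj.{u, v} M X).carrier) : p t := by
  obtain ⟨x, q⟩ := t
  induction q using Quotient.inductionOn' with
  | h m => exact h m x

theorem freeMk_eq_iff {X : SuppSet.{v, max u v} A} {m m' : M} {x : X.carrier} :
    freeMk.{u, v} m x = freeMk m' x ↔ Set.EqOn m.1 m'.1 (X.supp x) :=
  ⟨fun h => Quotient.exact (s := restSetoid M (X.supp x)) (eq_of_heq (Sigma.mk.inj h).2),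
    fun h => Sigma.ext rfl (heq_of_eq (Quotient.sound (s := restSetoid M (X.supp x)) h))⟩

theorem supp_freeMk (hl : LockFree M) {X : SuppSet.{v, max u v} A} (m : M) (x : X.carrier) :
    (freeObj.{u, v} M X).supp (freeMk m x) = imageOf (fun a : X.supp x => m.1 a) := by
  apply subset_antisymm
  · refine fun b hb => NomSet.mem_supp.1 hb _ fun l l' h => freeMk_eq_iff.2 fun a ha => ?_
    exact h (m.1 a) (mem_imageOf (fun a : X.supp x => m.1 a) ⟨a, ha⟩)
  · refine imageOf_subset fun a => NomSet.mem_supp.2 fun R hR => ?_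
    by_contra hmR
    obtain ⟨l, hlM, hlR, hne⟩ := hl R _ hmR
    exact hne (freeMk_eq_iff.1 (hR ⟨l, hlM⟩ 1 hlR) a.2)

/-- The unit `x ↦ ([1], x)` of the free-forgetful adjunction. -/
noncomputable def freeUnit (hl : LockFree M) :
    𝟭 (SuppSet.{v, max u v} A) ⟶ free.{u, v} M ⋙ forgetToSupp.{v, max u v} M where
  app _ := ⟨freeMk 1, fun x => (supp_freeMk hl 1 x).subset.trans (imageOf_subset fun a => a.2)⟩
  naturality _ _ _ := rfl

/-- The counit `([m], y) ↦ m • y` of the free-forgetful adjunction. -/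
noncomputable def freeCounit (hs : AdmitsLeastSupports.{v, max u v} M) :
    forgetToSupp.{v, max u v} M ⋙ free.{u, v} M ⟶ 𝟭 (NomSet.{v, max u v} M) where
  app Y := ⟨{
    toFun := fun t : (freeObj.{u, v} M ((forgetToSupp M).obj Y)).carrier =>
      Quotient.lift (s := restSetoid M (Y.supp t.1)) (fun m : M => m • (show Y.carrier from t.1))
        (hs.supports_supp Y t.1) t.2
    map_smul' := fun l => freeMk_induction fun m (y : Y.carrier) => mul_smul l m y }⟩
  naturality X _ f := NomSet.Hom.ext <| MulActionHom.ext <|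
    freeMk_induction fun m (y : X.carrier) => (map_smul f.hom m y).symm

/-- The adjunction between the free and the forgetful functor. -/
noncomputable def freeAdj (hs : AdmitsLeastSupports.{v, max u v} M) (hl : LockFree M) :
    free.{u, v} M ⊣ forgetToSupp.{v, max u v} M where
  unit := freeUnit hl
  counit := freeCounit hs
  left_triangle_components _ := NomSet.Hom.ext <| MulActionHom.ext <|
    freeMk_induction fun m x => congrArg (freeMk · x) (mul_one m)
  right_triangle_components Y := SuppSet.Hom.ext (funext (one_smul M (α := Y.carrier)))

end Adjunction

section Algebras

variable {A : Type v} {M : Submonoid (Function.End A)}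
  {hs : AdmitsLeastSupports.{v, max u v} M} {hl : LockFree M}

instance : (forgetToSupp.{v, w} M).Faithful where
  map_injective h :=
    NomSet.Hom.ext (MulActionHom.ext (congrFun (congrArg SuppSet.Hom.toFun h)))

/-- The nominal `M`-set of an algebra with structure map `a`, with the action
`m • x = a ([m], x)`. -/
def algebraNomSet (B : (freeAdj.{u, v} hs hl).toMonad.Algebra) : NomSet.{v, max u v} M where
  carrier := B.A.carrier
  action :=
    { smul := fun m x => B.a.toFun (freeMk.{u, v} m x)
      one_smul := congrFun (congrArg SuppSet.Hom.toFun B.unit)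
      mul_smul := fun l m x =>
        congrFun (congrArg SuppSet.Hom.toFun B.assoc) (freeMk l (freeMk.{u, v} m x)) }
  nominal x := ⟨B.A.supp x, fun _ _ h => congrArg B.a.toFun (freeMk_eq_iff.2 h)⟩

theorem supp_algebraNomSet (B : (freeAdj.{u, v} hs hl).toMonad.Algebra) (x : B.A.carrier) :
    (algebraNomSet B).supp x = B.A.supp x := by
  classical
  apply subset_antisymm
  · exact fun a ha => NomSet.mem_supp.1 ha _ fun _ _ h => congrArg B.a.toFun (freeMk_eq_iff.2 h)
  · refine fun a ha => NomSet.mem_supp.2 fun R hR => ?_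
    by_contra haR
    obtain ⟨l, hlM, hfix, hne⟩ := hl (R ∪ (B.A.supp x).erase a) a (by simp [haR])
    have hlx : B.a.toFun (freeMk.{u, v} ⟨l, hlM⟩ x) = x :=
      (hR ⟨l, hlM⟩ 1 fun b hb => hfix b (Finset.mem_union_left _ hb)).trans
        (one_smul M (show (algebraNomSet B).carrier from x))
    have hsub : B.A.supp x ⊆ imageOf fun b : B.A.supp x => l b := calc
      B.A.supp x = B.A.supp (B.a.toFun (freeMk.{u, v} ⟨l, hlM⟩ x)) := by rw [hlx]
      _ ⊆ _ := B.a.supp_subset _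
      _ = _ := supp_freeMk hl _ x
    obtain ⟨⟨b, hb⟩, hlb : l b = a⟩ := (Set.finite_range _).mem_toFinset.1 (hsub ha)
    have hba : b ≠ a := fun h => hne (h ▸ hlb)
    exact hba ((hfix b (by simp [hba, hb])).symm.trans hlb)

theorem SuppSet.eqToHom_eq {X : Type w} {s s' : X → Finset A} (h : s = s') :
    eqToHom (congrArg (SuppSet.mk X) h) = ⟨id, fun x => (congrFun h x).superset⟩ := by
  subst h
  rfl

theorem comparison_obj_algebraNomSet (B : (freeAdj.{u, v} hs hl).toMonad.Algebra) :
    (Monad.comparison (freeAdj hs hl)).obj (algebraNomSet B) = B := by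
  have hsupp := funext (supp_algebraNomSet B)
  have hA : ((Monad.comparison (freeAdj hs hl)).obj (algebraNomSet B)).A = B.A :=
    congrArg (SuppSet.mk B.A.carrier) hsupp
  have heqToHom : eqToHom hA = ⟨id, fun x => (congrFun hsupp x).superset⟩ :=
    SuppSet.eqToHom_eq hsupp
  refine algebra_eq_of_eqToHom hA ?_
  rw [heqToHom]
  exact SuppSet.Hom.ext (funext (freeMk_induction fun _ _ => rfl))

theorem comparison_freeAdj_full : (Monad.comparison (freeAdj.{u, v} hs hl)).Full where
  map_surjective {X Y} k := by
    have map_smul (m : M) (x : X.carrier) :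
        k.f.toFun (m • x) = m • (show Y.carrier from k.f.toFun x) :=
      (congrFun (congrArg SuppSet.Hom.toFun k.h)
        (freeMk.{u, v} (X := (forgetToSupp M).obj X) m x)).symm
    exact ⟨⟨⟨k.f.toFun, map_smul⟩⟩, rfl⟩

theorem isMonadicVia_freeAdj (hs : AdmitsLeastSupports.{v, max u v} M) (hl : LockFree M) :
    IsMonadicVia (forgetToSupp.{v, max u v} M) (freeAdj.{u, v} hs hl).toMonad :=
  .of_comparison _ comparison_freeAdj_full
    ⟨Function.LeftInverse.injective (g := algebraNomSet) fun _ => rfl,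
      fun B => ⟨_, comparison_obj_algebraNomSet B⟩⟩

end Algebras

/-! ### Explicit monads -/

section MonadIso

variable {A : Type v} {M : Submonoid (Function.End A)} {C : OpClass A}

/-- The maps of the class `C` are exactly the restrictions of the elements of `M` to finite sets
of atoms. Membership in `C` is tested on restrictions of total maps, which is no loss as maps on
finite sets extend to `A`. -/
def OpClass.IsRestrictionsOf (C : OpClass A) (M : Submonoid (Function.End A)) : Prop :=
  ∀ (S : Finset A) (f : A → A), C.IsOp S (fun a => f a) ↔ ∃ m : M, Set.EqOn m.1 f S

theorem OpClass.IsRestrictionsOf.isOp (hC : C.IsRestrictionsOf M) (S : Finset A) (m : M) :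
    C.IsOp S (fun a => m.1 a) :=
  (hC S m.1).2 ⟨m, Set.eqOn_refl _ _⟩

theorem OpClass.IsRestrictionsOf.exists_eq (hC : C.IsRestrictionsOf M) {S : Finset A} {p : S → A}
    (hp : C.IsOp S p) : ∃ m : M, (fun a : S => m.1 a) = p := by
  have hf : (fun a : S => Function.extend Subtype.val p id a.1) = p :=
    Function.extend_comp Subtype.val_injective p id
  obtain ⟨m, hm⟩ := (hC S (Function.extend Subtype.val p id)).1 (by rwa [hf])
  exact ⟨m, (funext fun a => hm a.2).trans hf⟩

/-- The class `[m]_S` as the restriction of `m` to `S`. -/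
noncomputable def RestMon.equivOps (hC : C.IsRestrictionsOf M) (S : Finset A) :
    RestMon M S ≃ {p : S → A // C.IsOp S p} :=
  Equiv.ofBijective
    (Quotient.lift (s := restSetoid M S) (fun m => ⟨fun a => m.1 a, hC.isOp S m⟩)
      fun _ _ h => Subtype.ext (funext fun a => h a a.2))
    ⟨by
      rintro ⟨m⟩ ⟨m'⟩ h
      exact Quotient.sound (s := restSetoid M S) fun a ha =>
        congrFun (congrArg Subtype.val h) ⟨a, ha⟩,
    fun ⟨_, hp⟩ =>
      let ⟨m, hm⟩ := hC.exists_eq hp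
      ⟨RestMon.mk S m, Subtype.ext hm⟩⟩

/-- An isomorphism of supported sets from a bijection that preserves supports. -/
def SuppSet.isoOfEquiv {X Y : SuppSet.{v, w} A} (e : X.carrier ≃ Y.carrier)
    (h : ∀ x, Y.supp (e x) = X.supp x) : X ≅ Y where
  hom := ⟨e, fun x => (h x).subset⟩
  inv := ⟨e.symm, fun y => by rw [← h, e.apply_symm_apply]⟩
  hom_inv_id := SuppSet.Hom.ext (funext e.symm_apply_apply)
  inv_hom_id := SuppSet.Hom.ext (funext e.apply_symm_apply)

/-- The isomorphism `([m], x) ↦ (m|_{supp x}, x)` between the supported set of a free nominal set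
and the explicit description. -/
noncomputable def freeIso (hC : C.IsRestrictionsOf M) (hl : LockFree M)
    (X : SuppSet.{v, max u v} A) :
    (forgetToSupp.{v, max u v} M).obj ((free.{u, v} M).obj X) ≅ OpClass.obj.{u, v} C X :=
  SuppSet.isoOfEquiv (Equiv.sigmaCongrRight fun x => RestMon.equivOps hC (X.supp x))
    (freeMk_induction fun m x => (supp_freeMk hl m x).symm)

/-- The isomorphism `([m], x) ↦ (m|_{supp x}, x)` from the monad of the free-forgetful adjunction
to the explicit monad. -/
noncomputable def freeMonadIso (hC : C.IsRestrictionsOf M)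
    (hs : AdmitsLeastSupports.{v, max u v} M) (hl : LockFree M) :
    (freeAdj.{u, v} hs hl).toMonad ≅ OpClass.monad.{u, v} C :=
  MonadIso.mk
    (NatIso.ofComponents (freeIso hC hl) fun _ =>
      SuppSet.Hom.ext (funext (freeMk_induction fun _ _ => rfl)))
    (fun _ => rfl)
    (fun _ => SuppSet.Hom.ext (funext (freeMk_induction fun _ =>
      freeMk_induction fun _ _ => rfl)))

theorem OpClass.IsRestrictionsOf.isMonadicInstance (hC : C.IsRestrictionsOf M)
    (hs : AdmitsLeastSupports.{v, max u v} M) (hl : LockFree M) :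
    IsMonadicInstance.{u, v} M C :=
  ⟨(isMonadicVia_freeAdj hs hl).of_iso (freeMonadIso hC hs hl), freeAdj hs hl,
    fun _ _ => rfl, freeMonadIso hC hs hl, fun X x m => ⟨hC.isOp (X.supp x) m, rfl⟩⟩

end MonadIso

/-! ### Finite partial maps -/

section Criteria

variable {A : Type v} {M : Submonoid (Function.End A)} {C : OpClass A}

theorem admitsLeastSupports_of_exists_eqOn [DecidableEq A]
    (h : ∀ (S R : Finset A), ∀ a ∈ S, a ∉ R → ∀ m m' : M, Set.EqOn m.1 m'.1 (S.erase a) →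
      ∃ l l' : M, Set.EqOn l.1 m.1 S ∧ Set.EqOn l'.1 m'.1 S ∧ Set.EqOn l.1 l'.1 R) :
    AdmitsLeastSupports.{v, w} M := by
  intro X x
  obtain ⟨S, hS, hmin⟩ := wellFounded_lt.has_min
    {S : Finset A | Supports M (S : Set A) x} (X.nominal x)
  refine ⟨S, hS, fun R hR a ha => ?_⟩
  by_contra haR
  refine hmin (S.erase a) (fun m m' hm => ?_) (Finset.erase_ssubset ha)
  obtain ⟨l, l', hl, hl', hll'⟩ := h S R a ha haR m m' hm
  calc m • x = l • x := (hS l m hl).symm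
    _ = l' • x := hR l l' hll'
    _ = m' • x := hS l' m' hl'

theorem OpClass.IsRestrictionsOf.admitsLeastSupports [DecidableEq A] (hC : C.IsRestrictionsOf M)
    (h : ∀ (S : Finset A) (m m' : M), ∃ f : A → A, ∀ R : Finset A,
      C.IsOp R (fun a => S.piecewise m.1 f a) ∧ C.IsOp R (fun a => S.piecewise m'.1 f a)) :
    AdmitsLeastSupports.{v, w} M := by
  refine admitsLeastSupports_of_exists_eqOn fun S R a _ haR m m' hm => ?_
  obtain ⟨f, hf⟩ := h S m m'
  obtain ⟨⟨l, hl⟩, l', hl'⟩ := (hf (S ∪ R)).imp (hC _ _).1 (hC _ _).1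
  refine ⟨l, l', fun b hb => ?_, fun b hb => ?_, fun b hb => ?_⟩
  · exact (hl (by simp_all)).trans (S.piecewise_eq_of_mem _ _ hb)
  · exact (hl' (by simp_all)).trans (S.piecewise_eq_of_mem _ _ hb)
  · refine (hl (by simp_all)).trans (Eq.trans ?_ (hl' (by simp_all)).symm)
    by_cases hbS : b ∈ S
    · have hmb : m.1 b = m'.1 b := hm (by simp [hbS, ne_of_mem_of_not_mem hb haR])
      exact (S.piecewise_eq_of_mem _ _ hbS).trans
        (hmb.trans (S.piecewise_eq_of_mem _ _ hbS).symm)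
    · exact (S.piecewise_eq_of_notMem _ _ hbS).trans (S.piecewise_eq_of_notMem _ _ hbS).symm

theorem OpClass.IsRestrictionsOf.lockFree [DecidableEq A] (hC : C.IsRestrictionsOf M)
    (h : ∀ (R : Finset A), ∀ a ∉ R,
      ∃ c ≠ a, C.IsOp (insert a R) (fun b => Function.update id a c b)) :
    LockFree M := by
  intro R a ha
  obtain ⟨c, hca, hc⟩ := h R a ha
  obtain ⟨m, hm⟩ := (hC _ _).1 hc
  refine ⟨m.1, m.2, fun b hb => ?_, ?_⟩
  · have hba : b ≠ a := ne_of_mem_of_not_mem hb ha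
    exact (hm (Finset.mem_insert_of_mem hb)).trans (Function.update_of_ne hba _ _)
  · exact (hm (Finset.mem_insert_self a R)).trans_ne ((Function.update_self ..).trans_ne hca)

end Criteria

section FinitePermutationsAndRenamings

variable {A : Type v}

theorem isOp_injectiveOps_iff {S : Finset A} {f : A → A} :
    (injectiveOps A).IsOp S (fun a => f a) ↔ Set.InjOn f S :=
  Set.injOn_iff_injective.symm

theorem swap_mem_finPerm [DecidableEq A] (a b : A) :
    (⇑(Equiv.swap a b) : Function.End A) ∈ finPerm A :=
  ⟨(Equiv.swap a b).bijective, (Set.toFinite {a, b}).subset fun c hc => by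
    by_contra h
    simp only [Set.mem_insert_iff, Set.mem_singleton_iff, not_or] at h
    exact hc (Equiv.swap_apply_of_ne_of_ne h.1 h.2)⟩

theorem exists_finPerm_eqOn (S : Finset A) (f : A → A) (hf : Set.InjOn f S) :
    ∃ m : finPerm A, Set.EqOn m.1 f S := by
  classical
  induction S using Finset.induction_on with
  | empty => exact ⟨1, fun _ ha => (Finset.notMem_empty _ ha).elim⟩
  | insert a S ha ih =>
    rw [Finset.coe_insert, Set.injOn_insert ha] at hf
    obtain ⟨m, hm⟩ := ih hf.1
    refine ⟨⟨_, swap_mem_finPerm (m.1 a) (f a)⟩ * m, fun b hb => ?_⟩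
    change Equiv.swap (m.1 a) (f a) (m.1 b) = f b
    rcases Finset.mem_insert.1 hb with rfl | hbS
    · exact Equiv.swap_apply_left _ _
    · have hne : m.1 b ≠ f a := fun h => hf.2 ⟨b, hbS, (hm hbS).symm.trans h⟩
      rw [Equiv.swap_apply_of_ne_of_ne (m.2.1.1.ne (ne_of_mem_of_not_mem hbS ha)) hne, hm hbS]

theorem exists_finRename_eqOn (S : Finset A) (f : A → A) :
    ∃ m : finRename A, Set.EqOn m.1 f S := by
  classical
  refine ⟨⟨S.piecewise f id, S.finite_toSet.subset fun a ha => ?_⟩,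
    fun a ha => S.piecewise_eq_of_mem f id ha⟩
  by_contra h
  exact ha (S.piecewise_eq_of_notMem f id h)

theorem isRestrictionsOf_finPerm : (injectiveOps A).IsRestrictionsOf (finPerm A) := fun S f =>
  isOp_injectiveOps_iff.trans
    ⟨exists_finPerm_eqOn S f, fun ⟨m, hm⟩ => (m.2.1.1.injOn).congr hm⟩

theorem isRestrictionsOf_finRename : (allOps A).IsRestrictionsOf (finRename A) := fun S f =>
  iff_of_true trivial (exists_finRename_eqOn S f)

theorem admitsLeastSupports_finRename : AdmitsLeastSupports.{v, w} (finRename A) := by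
  classical
  exact isRestrictionsOf_finRename.admitsLeastSupports fun _ _ _ =>
    ⟨id, fun _ => ⟨trivial, trivial⟩⟩

theorem lockFree_finRename [Nontrivial A] : LockFree (finRename A) := by
  classical
  exact isRestrictionsOf_finRename.lockFree fun _ a _ =>
    (exists_ne a).imp fun _ hc => ⟨hc, trivial⟩

variable [Infinite A]

theorem lockFree_finPerm : LockFree (finPerm A) := by
  classical
  refine isRestrictionsOf_finPerm.lockFree fun R a ha => ?_
  obtain ⟨c, hc⟩ := Infinite.exists_notMem_finset (insert a R)
  rw [Finset.mem_insert, not_or] at hc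
  refine ⟨c, hc.1, isOp_injectiveOps_iff.2 ?_⟩
  have hid : Set.EqOn (Function.update id a c) id R := fun b hb =>
    Function.update_of_ne (ne_of_mem_of_not_mem hb ha) _ _
  rw [Finset.coe_insert, Set.injOn_insert ha, hid.injOn_iff, hid.image_eq]
  exact ⟨Function.injective_id.injOn, by simpa using hc.2⟩

theorem exists_injective_forall_notMem (T : Finset A) :
    ∃ f : A → A, Function.Injective f ∧ ∀ a, f a ∉ T := by
  obtain ⟨e⟩ := Cardinal.eq.1 (Cardinal.mk_compl_finset_of_infinite T)
  exact ⟨fun a => e.symm a, Subtype.val_injective.comp e.symm.injective, fun a => (e.symm a).2⟩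

theorem admitsLeastSupports_finPerm : AdmitsLeastSupports.{v, w} (finPerm A) := by
  classical
  -- Off `S` use a common injection that avoids the values of both `m` and `m'` on `S`.
  refine isRestrictionsOf_finPerm.admitsLeastSupports fun S m m' => ?_
  obtain ⟨f, hf, hfT⟩ := exists_injective_forall_notMem (S.image m.1 ∪ S.image m'.1)
  have injective_piecewise (n : finPerm A) (hn : S.image n.1 ⊆ S.image m.1 ∪ S.image m'.1) :
      Function.Injective (S.piecewise n.1 f) := by
    have hpiecewise : S.piecewise n.1 f = (S : Set A).piecewise n.1 f :=
      (S.piecewise_coe n.1 f).symm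
    exact hpiecewise ▸ (Set.injective_piecewise_iff _).2 ⟨n.2.1.1.injOn, hf.injOn, fun a ha b _ h =>
      hfT b (h ▸ hn (Finset.mem_image_of_mem n.1 ha))⟩
  exact ⟨f, fun R =>
    ⟨(injective_piecewise m Finset.subset_union_left).comp Subtype.val_injective,
      (injective_piecewise m' Finset.subset_union_right).comp Subtype.val_injective⟩⟩

end FinitePermutationsAndRenamings

section Order

variable {Q : Type v} [LinearOrder Q]

theorem isOp_strictMonoOps_iff {S : Finset Q} {f : Q → Q} :
    (strictMonoOps Q).IsOp S (fun a => f a) ↔ StrictMonoOn f S :=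
  ⟨fun h a ha b hb hab => h ⟨a, ha⟩ ⟨b, hb⟩ hab, fun h a b hab => h a.2 b.2 hab⟩

theorem strictMono_coe_ordAut (m : ordAut Q) : StrictMono (m.1 : Q → Q) :=
  m.2.2.strictMono_of_injective m.2.1.1

theorem admitsLeastSupports_ordAut (hQ : (strictMonoOps Q).IsRestrictionsOf (ordAut Q)) :
    AdmitsLeastSupports.{v, w} (ordAut Q) := by
  refine admitsLeastSupports_of_exists_eqOn fun S R a _ haR m m' hm => ?_
  wlog hle : m.1 a ≤ m'.1 a generalizing m m'
  · obtain ⟨l, l', hl, hl', hll'⟩ := this m' m hm.symm (le_of_not_ge hle)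
    exact ⟨l', l, hl', hl, hll'.symm⟩
  have hmono' := strictMono_coe_ordAut m'
  have hmono := strictMono_coe_ordAut m
  -- Glue `m` below `a` to `m'` above `a`, letting either of them decide at `a`.
  obtain ⟨l, hl⟩ := (hQ (S ∪ R) fun b => if b ≤ a then m.1 b else m'.1 b).1 <|
    isOp_strictMonoOps_iff.2 <| StrictMono.strictMonoOn
      (hmono.ite' hmono' (fun _ _ hbc hca => hbc.le.trans hca) fun b c hb hc _ =>
        (hmono.monotone hb).trans_lt (hle.trans_lt (hmono' (not_le.1 hc)))) _
  obtain ⟨l', hl'⟩ := (hQ (S ∪ R) fun b => if b < a then m.1 b else m'.1 b).1 <|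
    isOp_strictMonoOps_iff.2 <| StrictMono.strictMonoOn
      (hmono.ite' hmono' (fun _ _ hbc hca => hbc.trans hca) fun b c hb hc _ =>
        (hmono hb).trans_le (hle.trans (hmono'.monotone (not_lt.1 hc)))) _
  have hm_of_ne {b} (hb : b ∈ S) (hba : b ≠ a) : m.1 b = m'.1 b := hm (by simp [hb, hba])
  refine ⟨l, l', fun b hb => ?_, fun b hb => ?_, fun b hb => ?_⟩
  · exact (hl (by simp_all)).trans
      (ite_eq_left_iff.2 fun h => (hm_of_ne hb (not_le.1 h).ne').symm)
  · exact (hl' (by simp_all)).trans (ite_eq_right_iff.2 fun h => hm_of_ne hb h.ne)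
  · have hba : b ≠ a := ne_of_mem_of_not_mem hb haR
    exact (hl (by simp_all)).trans ((if_congr hba.le_iff_lt rfl rfl).trans (hl' (by simp_all)).symm)

theorem lockFree_ordAut [DenselyOrdered Q] [NoMaxOrder Q]
    (hQ : (strictMonoOps Q).IsRestrictionsOf (ordAut Q)) : LockFree (ordAut Q) := by
  refine hQ.lockFree fun R a ha => ?_
  obtain ⟨d, had⟩ := exists_gt a
  have hT : (insert d {b ∈ R | a < b}).Nonempty := Finset.insert_nonempty _ _
  have haT : a < (insert d {b ∈ R | a < b}).min' hT := (Finset.lt_min'_iff _ hT).2 (by simp [had])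
  obtain ⟨c, hac, hcT⟩ := exists_between haT
  have hcR (b : Q) (hb : b ∈ R) (hab : a < b) : c < b :=
    hcT.trans_le (Finset.min'_le _ _ (by simp [hb, hab]))
  refine ⟨c, hac.ne', isOp_strictMonoOps_iff.2 ?_⟩
  have hid : Set.EqOn (Function.update id a c) id R := fun b hb =>
    Function.update_of_ne (ne_of_mem_of_not_mem hb ha) _ _
  rw [Finset.coe_insert, strictMonoOn_insert_iff, Function.update_self]
  refine ⟨fun b hb hba => ?_, fun b hb hab => ?_, strictMonoOn_id.congr hid.symm⟩
  · rw [hid hb]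
    exact hba.trans hac
  · rw [hid hb]
    exact hcR b hb hab

open FirstOrder Language in
theorem exists_orderIso_eqOn [Countable Q] [DenselyOrdered Q] [NoMinOrder Q] [NoMaxOrder Q]
    [Nonempty Q] {S : Finset Q} {f : Q → Q} (hf : StrictMonoOn f S) :
    ∃ o : Q ≃o Q, Set.EqOn o f S := by
  let : Language.order.Structure Q := Language.orderStructure Q
  have : Language.order.OrderedStructure Q := ⟨fun _ => Iff.rfl⟩
  have : Q ⊨ Language.order.dlo := Language.model_dlo
  let S' : Language.order.Substructure Q := ⟨S, isEmptyElim⟩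
  have : Finite S' := inferInstanceAs (Finite S)
  let i : S' ↪o Q := OrderEmbedding.ofStrictMono (fun a => f a) fun a b h => hf a.2 b.2 h
  obtain ⟨g, hg⟩ := (isFraisseLimit_of_countable_nonempty_dlo Q).ultrahomogeneous S'
    (Substructure.fg_iff_structure_fg _ |>.2 .of_finite) (StrongHomClass.toEmbedding i)
  have := StrongHomClass.toOrderIsoClass Language.order Q Q (Q ≃[Language.order] Q)
  exact ⟨OrderIsoClass.toOrderIso g, fun a ha => (DFunLike.congr_fun hg ⟨a, ha⟩).symm⟩

theorem isRestrictionsOf_ordAut [Countable Q] [DenselyOrdered Q] [NoMinOrder Q] [NoMaxOrder Q]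
    [Nonempty Q] : (strictMonoOps Q).IsRestrictionsOf (ordAut Q) := by
  refine fun S f => isOp_strictMonoOps_iff.trans ⟨fun hf => ?_, fun ⟨m, hm⟩ => ?_⟩
  · obtain ⟨o, ho⟩ := exists_orderIso_eqOn hf
    exact ⟨⟨⇑o, o.bijective, o.monotone⟩, ho⟩
  · exact ((strictMono_coe_ordAut m).strictMonoOn S).congr hm

end Order

/-! ### Relabelling -/

section Relabelling

variable {A : Type u} {B : Type v}

instance (e : A ≃ B) : (SuppSet.relabel.{u, v, w} e).Faithful where
  map_injective h := SuppSet.Hom.ext (congrArg SuppSet.Hom.toFun h :)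

instance (e : A ≃ B) : (SuppSet.relabel.{u, v, w} e).Full where
  map_surjective k := ⟨⟨k.toFun, fun x => Finset.map_subset_map.1 (k.supp_subset x)⟩, rfl⟩

theorem leftInverse_relabel_symm_obj (e : A ≃ B) :
    Function.LeftInverse (SuppSet.relabel.{v, u, w} e.symm).obj (SuppSet.relabel e).obj :=
  fun X => by simp [SuppSet.relabel, Finset.map_map]

theorem relabel_obj_bijective (e : A ≃ B) :
    Function.Bijective (SuppSet.relabel.{u, v, w} e).obj :=
  ⟨(leftInverse_relabel_symm_obj e).injective, (leftInverse_relabel_symm_obj e.symm).surjective⟩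

instance (e : A ≃ B) : (SuppSet.relabel.{u, v, w} e).IsEquivalence where
  essSurj := Functor.essSurj_of_surj (relabel_obj_bijective e).2

theorem IsMonadicVia.comp_relabel {D : Type*} [Category D] {U : D ⥤ SuppSet.{u, w} A}
    {T : Monad (SuppSet.{u, w} A)} (hU : IsMonadicVia U T) (e : A ≃ B) :
    ∃ T' : Monad (SuppSet.{v, w} B), IsMonadicVia (U ⋙ SuppSet.relabel e) T' :=
  ⟨_, hU.comp_equivalence (SuppSet.relabel e).asEquivalence (relabel_obj_bijective e)⟩

end Relabelling

end Nominal

theorem mainTheorem2_general (A : Type v) [Infinite A] (Q : Type w) [LinearOrder Q]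
    [DenselyOrdered Q] [NoMaxOrder Q]
    (hQ : (Nominal.strictMonoOps Q).IsRestrictionsOf (Nominal.ordAut Q)) :
    (Nominal.AdmitsLeastSupports.{v, max u v} (Nominal.finPerm A) ∧
      Nominal.LockFree (Nominal.finPerm A) ∧
      Nominal.IsMonadicInstance.{u, v} (Nominal.finPerm A) (Nominal.injectiveOps A)) ∧
    (Nominal.AdmitsLeastSupports.{v, max u v} (Nominal.finRename A) ∧
      Nominal.LockFree (Nominal.finRename A) ∧
      Nominal.IsMonadicInstance.{u, v} (Nominal.finRename A) (Nominal.allOps A)) ∧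
    (Nominal.AdmitsLeastSupports.{w, max u w} (Nominal.ordAut Q) ∧
      Nominal.LockFree (Nominal.ordAut Q) ∧
      Nominal.IsMonadicInstance.{u, w} (Nominal.ordAut Q) (Nominal.strictMonoOps Q)) ∧
    ∀ e : Q ≃ A, ∃ T : Monad (Nominal.SuppSet.{v, max u v w} A),
      Nominal.IsMonadicVia
        (Nominal.forgetToSupp.{w, max u v w} (Nominal.ordAut Q) ⋙
          Nominal.SuppSet.relabel.{w, v, max u v w} e) T := by
  have hperm := Nominal.admitsLeastSupports_finPerm.{v, max u v} (A := A)
  have hrename := Nominal.admitsLeastSupports_finRename.{v, max u v} (A := A)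
  have hord := Nominal.admitsLeastSupports_ordAut.{w, max u w} hQ
  have hord' := Nominal.admitsLeastSupports_ordAut.{w, max u v w} hQ
  have lperm := Nominal.lockFree_finPerm (A := A)
  have lrename := Nominal.lockFree_finRename (A := A)
  have lord := Nominal.lockFree_ordAut hQ
  exact ⟨⟨hperm, lperm, Nominal.isRestrictionsOf_finPerm.isMonadicInstance hperm lperm⟩,
    ⟨hrename, lrename, Nominal.isRestrictionsOf_finRename.isMonadicInstance hrename lrename⟩,
    ⟨hord, lord, hQ.isMonadicInstance hord lord⟩,
    (Nominal.isMonadicVia_freeAdj.{max u v, w} hord' lord).comp_relabel⟩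

theorem mainTheorem2 (A : Type v) [Countable A] [Infinite A] :
    -- nominal sets for the equality symmetry
    (Nominal.AdmitsLeastSupports.{v, max u v} (Nominal.finPerm A) ∧
      Nominal.LockFree (Nominal.finPerm A) ∧
      Nominal.IsMonadicInstance.{u, v} (Nominal.finPerm A) (Nominal.injectiveOps A)) ∧
    -- nominal renaming sets
    (Nominal.AdmitsLeastSupports.{v, max u v} (Nominal.finRename A) ∧
      Nominal.LockFree (Nominal.finRename A) ∧
      Nominal.IsMonadicInstance.{u, v} (Nominal.finRename A) (Nominal.allOps A)) ∧
    -- nominal sets for the total order symmetry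
    (Nominal.AdmitsLeastSupports.{0, u} (Nominal.ordAut ℚ) ∧
      Nominal.LockFree (Nominal.ordAut ℚ) ∧
      Nominal.IsMonadicInstance.{u, 0} (Nominal.ordAut ℚ) (Nominal.strictMonoOps ℚ)) ∧
    -- hence they are monadic over the supported sets over `A` as well, via `ℚ ≃ A`
    Nonempty (ℚ ≃ A) ∧
    ∀ e : ℚ ≃ A, ∃ T : CategoryTheory.Monad (Nominal.SuppSet.{v, max u v} A),
      Nominal.IsMonadicVia
        (CategoryTheory.Functor.comp (Nominal.forgetToSupp.{0, max u v} (Nominal.ordAut ℚ))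
          (Nominal.SuppSet.relabel.{0, v, max u v} e)) T := by
  obtain ⟨perm, rename, order, relabel⟩ :=
    mainTheorem2_general.{u} A ℚ Nominal.isRestrictionsOf_ordAut
  exact ⟨perm, rename, order, nonempty_equiv_of_countable, relabel⟩
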